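/- Let $\mathbb H^2=\{z=x+iy\in\mathbb C: y>0\}$ with the metric $(dx^2+dy^2)/y^2$, let $\mathrm{PSL}(2,\mathbb R)=\mathrm{SL}(2,\mathbb R)/\{\pm E_2\}$ act on $\mathbb H^2$ by Möbius transformations and on $T^1\mathbb H^2$ by their differentials, and let $\Gamma\subset\mathrm{PSL}(2,\mathbb R)$ be a discrete subgroup which acts on $\mathbb H^2$ without fixed points (that is, no $\gamma\in\Gamma\setminus\{e\}$ fixes a point of $\mathbb H^2$) and for which $\Gamma\backslash\mathbb H^2$ is compact. Identify $\mathrm{PSL}(2,\mathbb R)$ with $T^1\mathbb H^2$ by letting $g$ correspond to the image under $g$ of the upward unit vector at $i$, and hence $\Gamma\backslash\mathrm{PSL}(2,\mathbb R)$ with $\mathcal X=T^1(\Gamma\backslash\mathbb H^2)=\Gamma\backslash T^1\mathbb H^2$. The (stable) horocycle flow on $\mathcal X$ is $\theta_t(\Gamma g)=\Gamma g b_t$, $t\in\mathbb R$, where $b_t\in\mathrm{PSL}(2,\mathbb R)$ is the class of $\begin{pmatrix}1&t\\0&1\end{pmatrix}$. Let $d$ be any metric on $\mathcal X$ that induces its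 topology. A continuous flow $\psi$ on $\mathcal X$ is called a time change of $\theta$ if for every $x\in\mathcal X$ the orbits of $x$ under $\psi$ and $\theta$ coincide, together with their orientations; that is, the orbits coincide as sets and there is a continuous strictly increasing $h:\mathbb R\to\mathbb R$ with $h(0)=0$ and $\psi_t(x)=\theta_{h(t)}(x)$ for all $t\in\mathbb R$. **Theorem.** The horocycle flow $\theta$ on $\mathcal X$ is positive and negative strong kinematic expansive. That is, for every time change $\psi$ of $\theta$ and every $\varepsilon>0$: (positive) there is $\delta>0$ such that for all $x,y\in\mathcal X$, if $d(\psi_t(x),\psi_t(y))<\delta$ for all $t\ge 0$, then $y=\psi_\tau(x)$ for some $\tau$ with $|\tau|<\varepsilon$; (negative) there is $\delta>0$ such that for all $x,y\in\mathcal X$, if $d(\psi_t(x),\psi_t(y))<\delta$ for all $t\le 0$, then $y=\psi_\tau(x)$ for some $\tau$ with $|\tau|<\varepsilon$. -/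

import Mathlib

open UpperHalfPlane
open scoped MatrixGroups

noncomputable section

/-! ### The action of `PSL(2, ℝ)` on the hyperbolic plane and on its unit tangent bundle -/

namespace HoroExp

/-- The unit tangent bundle `T¹ℍ²`: pairs of a base point `z` and a tangent vector `v ∈ T_zℍ² = ℂ` of
norm one for the hyperbolic metric `(dx² + dy²) / y²`, i.e. `‖v‖ / im z = 1`. -/
def T1H : Type := {p : ℍ × ℂ // ‖p.2‖ = p.1.im}

instance : TopologicalSpace T1H := inferInstanceAs (TopologicalSpace {p : ℍ × ℂ // ‖p.2‖ = p.1.im})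

/-- The base point of a unit tangent vector. -/
def T1H.base (p : T1H) : ℍ := p.1.1

/-- The vector part of a unit tangent vector. -/
def T1H.vec (p : T1H) : ℂ := p.1.2

theorem T1H.ext {p q : T1H} (h1 : p.base = q.base) (h2 : p.vec = q.vec) : p = q :=
  Subtype.ext (Prod.ext h1 h2)

theorem T1H.norm_vec (p : T1H) : ‖p.vec‖ = p.base.im := p.2

theorem T1H.continuous_base : Continuous T1H.base := continuous_fst.comp continuous_subtype_val

theorem T1H.continuous_vec : Continuous T1H.vec := continuous_snd.comp continuous_subtype_val

/-- The factor `c z + d` of a matrix with bottom row `(c, d)`. -/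
def den (g : SL(2, ℝ)) (z : ℍ) : ℂ := (g 1 0 : ℂ) * z + (g 1 1 : ℂ)

theorem det_eq (g : SL(2, ℝ)) : g 0 0 * g 1 1 - g 0 1 * g 1 0 = 1 := by
  rw [← Matrix.det_fin_two]; exact g.2

theorem den_ne_zero (g : SL(2, ℝ)) (z : ℍ) : den g z ≠ 0 := by
  intro h
  have h1 := congrArg Complex.im h
  have h2 := congrArg Complex.re h
  simp [den] at h1 h2
  have hd := det_eq g
  rcases h1 with h1 | h1
  · simp [h1] at h2
    simp [h1, h2] at hd
  · exact z.im_ne_zero h1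

theorem coe_smul (g : SL(2, ℝ)) (z : ℍ) :
    ((g • z : ℍ) : ℂ) = ((g 0 0 : ℂ) * z + (g 0 1 : ℂ)) / den g z := by
  rw [UpperHalfPlane.specialLinearGroup_apply]
  simp [den]

theorem im_smul (g : SL(2, ℝ)) (z : ℍ) : (g • z).im = z.im / ‖den g z‖ ^ 2 := by
  have h := coe_smul g z
  have h1 : (g • z).im = (((g • z : ℍ) : ℂ)).im := rfl
  have hn : Complex.normSq (den g z) ≠ 0 := by simpa using den_ne_zero g z
  rw [h1, h, ← Complex.normSq_eq_norm_sq, Complex.div_im]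
  have hd := det_eq g
  rw [← sub_div]
  congr 1
  simp [den]
  linear_combination (z.im) * hd

theorem den_mul (g h : SL(2, ℝ)) (z : ℍ) : den (g * h) z = den g (h • z) * den h z := by
  have hh := den_ne_zero h z
  have h2 : den g (h • z) = (g 1 0 : ℂ) * ((h • z : ℍ) : ℂ) + (g 1 1 : ℂ) := rfl
  rw [h2, coe_smul]
  field_simp
  simp [den, Matrix.mul_apply, Fin.sum_univ_two]
  ring

/-- The Möbius transformation of `g` has derivative `1 / (c z + d)²` at `z`. -/
theorem hasDerivAt_moebius (g : SL(2, ℝ)) (z : ℍ) :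
    HasDerivAt (fun w : ℂ => ((g 0 0 : ℂ) * w + (g 0 1 : ℂ)) / ((g 1 0 : ℂ) * w + (g 1 1 : ℂ)))
      (1 / den g z ^ 2) (z : ℂ) := by
  have h1 : HasDerivAt (fun w : ℂ => (g 0 0 : ℂ) * w + (g 0 1 : ℂ)) (g 0 0 : ℂ) (z : ℂ) := by
    simpa using ((hasDerivAt_id (z : ℂ)).const_mul (g 0 0 : ℂ)).add_const (g 0 1 : ℂ)
  have h2 : HasDerivAt (fun w : ℂ => (g 1 0 : ℂ) * w + (g 1 1 : ℂ)) (g 1 0 : ℂ) (z : ℂ) := by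
    simpa using ((hasDerivAt_id (z : ℂ)).const_mul (g 1 0 : ℂ)).add_const (g 1 1 : ℂ)
  have h3 := h1.div h2 (den_ne_zero g z)
  have hd : (g 0 0 : ℂ) * g 1 1 - g 0 1 * g 1 0 = 1 := by exact_mod_cast det_eq g
  refine h3.congr_deriv ?_
  rw [← show den g z = (g 1 0 : ℂ) * (z : ℂ) + (g 1 1 : ℂ) from rfl]
  refine congrArg (fun u : ℂ => u / den g z ^ 2) ?_
  simp only [den]
  linear_combination hd

/-- `SL(2, ℝ)` acts on `T¹ℍ²` by the differentials of its Möbius transformations: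
`g • (z, v) = (g z, v / (c z + d)²)`. -/
instance : MulAction SL(2, ℝ) T1H where
  smul g p := ⟨(g • p.base, p.vec / den g p.base ^ 2), by
    simp only [norm_div, norm_pow, p.norm_vec, im_smul]⟩
  one_smul p := by
    refine T1H.ext (one_smul _ p.base) ?_
    change p.vec / den 1 p.base ^ 2 = p.vec
    simp [den]
  mul_smul g h p := by
    refine T1H.ext (mul_smul g h p.base) ?_
    change p.vec / den (g * h) p.base ^ 2 = p.vec / den h p.base ^ 2 / den g (h • p.base) ^ 2
    rw [den_mul, div_div]
    ring

theorem base_smul (g : SL(2, ℝ)) (p : T1H) : (g • p).base = g • p.base := rfl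

theorem vec_smul (g : SL(2, ℝ)) (p : T1H) : (g • p).vec = p.vec / den g p.base ^ 2 := rfl

theorem center_cases {g : SL(2, ℝ)} (hg : g ∈ Subgroup.center SL(2, ℝ)) : g = 1 ∨ g = -1 := by
  rw [Matrix.SpecialLinearGroup.mem_center_iff] at hg
  obtain ⟨r, hr, h⟩ := hg
  simp only [Fintype.card_fin] at hr
  rcases sq_eq_sq_iff_eq_or_eq_neg.mp (hr.trans (one_pow 2).symm) with h1 | h1
  · left; ext i j; rw [← h, h1]; simp
  · right; ext i j; rw [← h, h1]; fin_cases i <;> fin_cases j <;> simp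

theorem neg_one_mem_center : (-1 : SL(2, ℝ)) ∈ Subgroup.center SL(2, ℝ) := by
  rw [Subgroup.mem_center_iff]
  intro g
  simp

theorem neg_smul_H (g : SL(2, ℝ)) (z : ℍ) : (-g) • z = g • z := by
  apply UpperHalfPlane.ext
  rw [coe_smul, coe_smul, ← neg_div_neg_eq]
  simp [den]
  ring_nf

theorem neg_smul_T1H (g : SL(2, ℝ)) (p : T1H) : (-g) • p = g • p := by
  refine T1H.ext (neg_smul_H g p.base) ?_
  rw [vec_smul, vec_smul]
  congr 1
  simp [den]
  ring

/-- The action of `PSL(2, ℝ)` on `ℍ²` by Möbius transformations. -/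
instance actH : MulAction PSL(2, ℝ) ℍ :=
  MulAction.compHom ℍ (QuotientGroup.lift (Subgroup.center SL(2, ℝ))
    (MulAction.toPermHom SL(2, ℝ) ℍ) (by
      intro g hg
      ext1 z
      rcases center_cases hg with h | h
      · simp [h]
      · rw [h]; exact (neg_smul_H 1 z).trans (one_smul _ z)))

/-- The action of `PSL(2, ℝ)` on `T¹ℍ²` by differentials of Möbius transformations. -/
instance actT1H : MulAction PSL(2, ℝ) T1H :=
  MulAction.compHom T1H (QuotientGroup.lift (Subgroup.center SL(2, ℝ))
    (MulAction.toPermHom SL(2, ℝ) T1H) (by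
      intro g hg
      ext1 p
      rcases center_cases hg with h | h
      · simp [h]
      · rw [h]; exact (neg_smul_T1H 1 p).trans (one_smul _ p)))

theorem mk_smul_H (g : SL(2, ℝ)) (z : ℍ) : (g : PSL(2, ℝ)) • z = g • z := rfl

theorem mk_smul_T1H (g : SL(2, ℝ)) (p : T1H) : (g : PSL(2, ℝ)) • p = g • p := rfl

theorem mk_neg (g : SL(2, ℝ)) : ((-g : SL(2, ℝ)) : PSL(2, ℝ)) = (g : PSL(2, ℝ)) := by
  rw [eq_comm, QuotientGroup.eq]
  simpa using neg_one_mem_center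

theorem continuous_smul_T1H (g : PSL(2, ℝ)) : Continuous (fun p : T1H => g • p) := by
  obtain ⟨g, rfl⟩ := QuotientGroup.mk_surjective g
  refine Continuous.subtype_mk (Continuous.prodMk ?_ ?_) _
  · exact T1H.continuous_base.const_smul g
  · refine T1H.continuous_vec.div ?_ (fun p => pow_ne_zero 2 (den_ne_zero g _))
    unfold den
    have := UpperHalfPlane.continuous_coe.comp T1H.continuous_base
    simp only [Function.comp_def] at this
    fun_prop

instance : ContinuousConstSMul PSL(2, ℝ) T1H := ⟨continuous_smul_T1H⟩

instance (Γ : Subgroup PSL(2, ℝ)) : ContinuousConstSMul Γ T1H :=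
  ⟨fun γ => continuous_smul_T1H (γ : PSL(2, ℝ))⟩

/-! ### The identification of `PSL(2, ℝ)` with `T¹ℍ²` -/

/-- The upward unit vector `i` at the point `i`. -/
def ref : T1H := ⟨(UpperHalfPlane.I, Complex.I), by simp⟩

/-- A square root of `i / v`. -/
def root (p : T1H) : ℂ := (Complex.I / p.vec) ^ (1 / 2 : ℂ)

/-- The matrix with bottom row `(im w, re w)` and top row `(im (z w), re (z w))`. -/
def secMat (p : T1H) (w : ℂ) (hw : w ^ 2 = Complex.I / p.vec) : SL(2, ℝ) :=
  ⟨!![((p.base : ℂ) * w).im, ((p.base : ℂ) * w).re; w.im, w.re], by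
    have h1 : ‖w‖ ^ 2 = 1 / p.base.im := by
      rw [← norm_pow, hw, norm_div, p.norm_vec]; simp
    have h2 : ‖w‖ ^ 2 = w.re ^ 2 + w.im ^ 2 := by
      rw [← Complex.normSq_eq_norm_sq, Complex.normSq_apply]; ring
    rw [h2, eq_div_iff p.base.im_ne_zero] at h1
    rw [Matrix.det_fin_two]
    simp
    linear_combination h1⟩

theorem vec_ne_zero (p : T1H) : p.vec ≠ 0 := by
  rw [← norm_ne_zero_iff, p.norm_vec]; exact p.base.im_ne_zero

theorem secMat_smul (p : T1H) (w : ℂ) (hw : w ^ 2 = Complex.I / p.vec) :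
    secMat p w hw • ref = p := by
  have hv := vec_ne_zero p
  have hw0 : w ≠ 0 := by
    rintro rfl
    exact div_ne_zero Complex.I_ne_zero hv (by simpa using hw.symm)
  have hden : den (secMat p w hw) UpperHalfPlane.I = w := by
    simp only [den, secMat, Matrix.SpecialLinearGroup.coe_mk]
    apply Complex.ext <;> simp
  refine T1H.ext ?_ ?_
  · apply UpperHalfPlane.ext
    rw [base_smul, coe_smul]
    change _ / den (secMat p w hw) UpperHalfPlane.I = _
    rw [hden, div_eq_iff hw0]
    simp only [ref, T1H.base, secMat, Matrix.SpecialLinearGroup.coe_mk]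
    apply Complex.ext <;> simp
  · rw [vec_smul]
    change Complex.I / den (secMat p w hw) UpperHalfPlane.I ^ 2 = _
    rw [hden, hw]
    field_simp [Complex.I_ne_zero]

theorem root_sq (p : T1H) : root p ^ 2 = Complex.I / p.vec := by
  unfold root
  rw [← Complex.cpow_nat_mul]
  simp

theorem smul_ref_injective {g h : PSL(2, ℝ)} (hgh : g • ref = h • ref) : g = h := by
  have key : ∀ k : PSL(2, ℝ), k • ref = ref → k = 1 := by
    intro k hk
    obtain ⟨k, rfl⟩ := QuotientGroup.mk_surjective k
    have hk' : k • ref = ref := hk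
    have hb := congrArg (fun p : T1H => (p.base : ℂ)) hk'
    have hv := congrArg T1H.vec hk'
    simp only [base_smul, vec_smul, coe_smul] at hb hv
    change _ / den k UpperHalfPlane.I = Complex.I at hb
    change Complex.I / den k UpperHalfPlane.I ^ 2 = Complex.I at hv
    have hd0 := den_ne_zero k UpperHalfPlane.I
    have hsq : den k UpperHalfPlane.I ^ 2 = 1 := by
      have h0 : den k UpperHalfPlane.I ^ 2 ≠ 0 := pow_ne_zero 2 hd0
      rw [div_eq_iff h0] at hv
      exact (mul_left_cancel₀ Complex.I_ne_zero (by rw [mul_one]; exact hv)).symm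
    rw [div_eq_iff hd0] at hb
    have hbr := congrArg Complex.re hb
    have hbi := congrArg Complex.im hb
    simp [ref, T1H.base, den] at hbr hbi
    rcases sq_eq_sq_iff_eq_or_eq_neg.mp (hsq.trans (one_pow 2).symm) with h1 | h1
    all_goals
      have hr := congrArg Complex.re h1
      have hi := congrArg Complex.im h1
      simp [den] at hr hi
    · have : k = 1 := by
        ext i j
        fin_cases i <;> fin_cases j <;> simp [*]
      rw [this]; rfl
    · have : k = -1 := by
        ext i j
        fin_cases i <;> fin_cases j <;> simp [*]
      rw [this]; exact mk_neg 1
  have := key (h⁻¹ * g) (by rw [mul_smul, hgh, inv_smul_smul])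
  exact (inv_mul_eq_one.mp this).symm

/-- The identification `PSL(2, ℝ) ≃ T¹ℍ²`, `g ↦ g • (i, i)`. -/
def Xi : PSL(2, ℝ) ≃ T1H :=
  Equiv.ofBijective (fun g => g • ref)
    ⟨fun _ _ h => smul_ref_injective h, fun p =>
      ⟨(secMat p (root p) (root_sq p) : PSL(2, ℝ)), secMat_smul p (root p) (root_sq p)⟩⟩

theorem Xi_apply (g : PSL(2, ℝ)) : Xi g = g • ref := rfl

theorem Xi_mul (g h : PSL(2, ℝ)) : Xi (g * h) = g • Xi h := mul_smul g h ref

theorem Xi_symm_eq (p : T1H) (w : ℂ) (hw : w ^ 2 = Complex.I / p.vec) :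
    Xi.symm p = (secMat p w hw : PSL(2, ℝ)) := by
  rw [Equiv.symm_apply_eq]
  exact (secMat_smul p w hw).symm

theorem Xi_symm_smul (g : PSL(2, ℝ)) (p : T1H) : Xi.symm (g • p) = g * Xi.symm p := by
  rw [Equiv.symm_apply_eq, Xi_mul, Equiv.apply_symm_apply]

theorem continuous_Xi : Continuous Xi := by
  refine (QuotientGroup.isOpenQuotientMap_mk.isQuotientMap).continuous_iff.mpr ?_
  refine Continuous.subtype_mk (Continuous.prodMk ?_ ?_) _
  · exact continuous_id.smul continuous_const
  · refine continuous_const.div ?_ (fun g => pow_ne_zero 2 (den_ne_zero g _))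
    unfold den
    have h : ∀ i j, Continuous (fun g : SL(2, ℝ) => ((g i j : ℝ) : ℂ)) := fun i j =>
      Complex.continuous_ofReal.comp
        ((continuous_apply_apply i j).comp continuous_subtype_val)
    exact (((h 1 0).mul continuous_const).add (h 1 1)).pow 2

theorem continuousAt_secMat (p : T1H) (f : T1H → ℂ) (hf : ∀ q, f q ^ 2 = Complex.I / q.vec)
    (hc : ContinuousAt f p) : ContinuousAt Xi.symm p := by
  have h1 : Xi.symm = fun q => (secMat q (f q) (hf q) : PSL(2, ℝ)) :=
    funext fun q => Xi_symm_eq q (f q) (hf q)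
  rw [h1]
  have h2 : ContinuousAt (fun q => secMat q (f q) (hf q)) p := by
    have hz : Continuous (fun q : T1H => (q.base : ℂ)) :=
      UpperHalfPlane.continuous_coe.comp T1H.continuous_base
    have hzf : ContinuousAt (fun q => (q.base : ℂ) * f q) p := hz.continuousAt.mul hc
    refine Topology.IsInducing.subtypeVal.continuousAt_iff.mpr ?_
    refine continuousAt_pi.mpr fun i => continuousAt_pi.mpr fun j => ?_
    fin_cases i <;> fin_cases j
    · exact Complex.continuous_im.continuousAt.comp hzf
    · exact Complex.continuous_re.continuousAt.comp hzf
    · exact Complex.continuous_im.continuousAt.comp hc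
    · exact Complex.continuous_re.continuousAt.comp hc
  exact QuotientGroup.continuous_mk.continuousAt.comp h2

theorem continuous_Xi_symm : Continuous Xi.symm := by
  rw [continuous_iff_continuousAt]
  intro p
  have hv := vec_ne_zero p
  have hq : Continuous (fun q : T1H => Complex.I / q.vec) :=
    continuous_const.div T1H.continuous_vec vec_ne_zero
  have hne : Complex.I / p.vec ≠ 0 := div_ne_zero Complex.I_ne_zero hv
  by_cases hs : Complex.I / p.vec ∈ Complex.slitPlane
  · exact continuousAt_secMat p root root_sq (hq.continuousAt.cpow continuousAt_const hs)
  · have hs' : -(Complex.I / p.vec) ∈ Complex.slitPlane := by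
      rw [Complex.mem_slitPlane_iff] at hs ⊢
      push Not at hs
      left
      rcases hs.1.lt_or_eq with h | h
      · simpa using h
      · exact absurd (Complex.ext h hs.2) hne
    refine continuousAt_secMat p
      (fun q => Complex.I * (-(Complex.I / q.vec)) ^ (1 / 2 : ℂ)) (fun q => ?_)
      (continuousAt_const.mul (hq.neg.continuousAt.cpow continuousAt_const hs'))
    rw [mul_pow, ← Complex.cpow_nat_mul]
    simp

/-! ### The horocycle flow -/

/-- The matrix with rows `(1, t)` and `(0, 1)`. -/
def B (t : ℝ) : SL(2, ℝ) := ⟨!![1, t; 0, 1], by simp⟩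

/-- The class of `B t` in `PSL(2, ℝ)`. -/
def b (t : ℝ) : PSL(2, ℝ) := (B t : PSL(2, ℝ))

theorem b_zero : b 0 = 1 := by
  have h : B 0 = 1 := by
    ext i j; fin_cases i <;> fin_cases j <;> simp [B]
  rw [b, h]; rfl

theorem b_add (s t : ℝ) : b (s + t) = b t * b s := by
  have h : B (s + t) = B t * B s := by
    ext i j
    rw [Matrix.SpecialLinearGroup.coe_mul]
    fin_cases i <;> fin_cases j <;> simp [B]
  rw [b, h]; rfl

theorem continuous_b : Continuous b := by
  refine QuotientGroup.continuous_mk.comp (Continuous.subtype_mk ?_ _)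
  refine continuous_matrix fun i j => ?_
  fin_cases i <;> fin_cases j <;> simp <;> fun_prop

/-- The stable horocycle flow on `T¹ℍ²`: in the identification of `T¹ℍ²` with `PSL(2, ℝ)` it is
`g ↦ g * b t`. The orbit of the vector `(i, i)` consists of the upward unit vectors along the
horocycle `im z = 1`, run through with unit speed. -/
def horocycleFlowH : Flow ℝ T1H where
  toFun t p := Xi (Xi.symm p * b t)
  cont' := continuous_Xi.comp
    ((continuous_Xi_symm.comp continuous_snd).mul (continuous_b.comp continuous_fst))
  map_add' s t p := by simp [b_add, mul_assoc]
  map_zero' p := by simp [b_zero]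

theorem horocycleFlowH_smul (g : PSL(2, ℝ)) (t : ℝ) (p : T1H) :
    horocycleFlowH t (g • p) = g • horocycleFlowH t p := by
  change Xi (Xi.symm (g • p) * b t) = g • Xi (Xi.symm p * b t)
  rw [Xi_symm_smul, mul_assoc, Xi_mul]

theorem horocycleFlowH_Xi (g : PSL(2, ℝ)) (t : ℝ) : horocycleFlowH t (Xi g) = Xi (g * b t) := by
  change Xi (Xi.symm (Xi g) * b t) = _
  rw [Equiv.symm_apply_apply]

/-- The orbit of the vector `(i, i)` is `t ↦ (i + t, i)`. -/
theorem horocycleFlowH_ref (t : ℝ) :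
    ((horocycleFlowH t ref).base : ℂ) = Complex.I + t ∧ (horocycleFlowH t ref).vec = Complex.I := by
  have h : horocycleFlowH t ref = B t • ref := by
    have h1 : Xi 1 = ref := one_smul PSL(2, ℝ) ref
    have h2 := horocycleFlowH_Xi 1 t
    rw [h1, one_mul] at h2
    exact h2
  rw [h, base_smul, coe_smul, vec_smul]
  simp [den, B, ref, T1H.base, T1H.vec]

/-- The unit tangent bundle `T¹(Γ\ℍ²) = Γ\T¹ℍ²`, with the quotient topology. -/
abbrev T1 (Γ : Subgroup PSL(2, ℝ)) : Type := MulAction.orbitRel.Quotient Γ T1H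

theorem isOpenQuotientMap_mk (Γ : Subgroup PSL(2, ℝ)) :
    IsOpenQuotientMap (Quotient.mk (MulAction.orbitRel Γ T1H) : T1H → T1 Γ) :=
  ⟨Quotient.mk_surjective, continuous_quotient_mk', isOpenMap_quotient_mk'_mul⟩

/-- The (stable) horocycle flow on `T¹(Γ\ℍ²)`, induced by that on `T¹ℍ²`. -/
def horocycleFlow (Γ : Subgroup PSL(2, ℝ)) : Flow ℝ (T1 Γ) where
  toFun t := Quotient.map (horocycleFlowH t) (by
    rintro p q ⟨γ, rfl⟩
    exact ⟨γ, (horocycleFlowH_smul (γ : PSL(2, ℝ)) t q).symm⟩)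
  cont' := by
    rw [((IsOpenQuotientMap.id (X := ℝ)).prodMap
      (isOpenQuotientMap_mk Γ)).isQuotientMap.continuous_iff]
    exact continuous_quotient_mk'.comp horocycleFlowH.cont'
  map_add' s t := by
    rintro ⟨p⟩
    exact congrArg (Quotient.mk _) (horocycleFlowH.map_add s t p)
  map_zero' := by
    rintro ⟨p⟩
    exact congrArg (Quotient.mk _) (horocycleFlowH.map_zero_apply p)

/-! ### Time changes and expansiveness -/

section Expansive

variable {M : Type*} [TopologicalSpace M]

/-- `d` is a metric on the topological space `M` that induces the given topology of `M`. -/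
structure IsCompatibleMetric (d : M → M → ℝ) : Prop where
  eq_zero_iff : ∀ x y, d x y = 0 ↔ x = y
  symm : ∀ x y, d x y = d y x
  triangle : ∀ x y z, d x z ≤ d x y + d y z
  isOpen_iff : ∀ s : Set M, IsOpen s ↔ ∀ x ∈ s, ∃ ε : ℝ, 0 < ε ∧ ∀ y, d x y < ε → y ∈ s

/-- `ψ` is a time change of `φ`: the orbits of every point under the two flows coincide, and so do
their orientations, i.e. `ψ` runs through the orbit of `x` along a continuous, strictly increasing
reparametrization of `t ↦ φ t x`. -/
def IsTimeChange (ψ φ : Flow ℝ M) : Prop :=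
  ∀ x : M, ψ.orbit x = φ.orbit x ∧
    ∃ h : ℝ → ℝ, Continuous h ∧ StrictMono h ∧ h 0 = 0 ∧ ∀ t, ψ t x = φ (h t) x

/-- Positive kinematic expansiveness of a flow with respect to the metric `d`. -/
def IsPositiveKinematicExpansive (d : M → M → ℝ) (φ : Flow ℝ M) : Prop :=
  ∀ ε : ℝ, 0 < ε → ∃ δ : ℝ, 0 < δ ∧ ∀ x y : M,
    (∀ t : ℝ, 0 ≤ t → d (φ t x) (φ t y) < δ) → ∃ τ : ℝ, |τ| < ε ∧ y = φ τ x

/-- Negative kinematic expansiveness of a flow with respect to the metric `d`. -/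
def IsNegativeKinematicExpansive (d : M → M → ℝ) (φ : Flow ℝ M) : Prop :=
  ∀ ε : ℝ, 0 < ε → ∃ δ : ℝ, 0 < δ ∧ ∀ x y : M,
    (∀ t : ℝ, t ≤ 0 → d (φ t x) (φ t y) < δ) → ∃ τ : ℝ, |τ| < ε ∧ y = φ τ x

/-- Every time change of the flow is positive kinematic expansive. -/
def IsPositiveStrongKinematicExpansive (d : M → M → ℝ) (φ : Flow ℝ M) : Prop :=
  ∀ ψ : Flow ℝ M, IsTimeChange ψ φ → IsPositiveKinematicExpansive d ψ

/-- Every time change of the flow is negative kinematic expansive. -/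
def IsNegativeStrongKinematicExpansive (d : M → M → ℝ) (φ : Flow ℝ M) : Prop :=
  ∀ ψ : Flow ℝ M, IsTimeChange ψ φ → IsNegativeKinematicExpansive d ψ

end Expansive

end HoroExp

end

/-!
The space `T¹(Γ\ℍ²) = Γ\PSL(2, ℝ)` carries the right multiplication action of `SL(2, ℝ)`, written
`x <• m`, in which the horocycle flow is `x <• B t`. The argument uses only that the space is compact,
that orbit maps are open (`openOrbitMaps_T1`) and that stabilizers avoid a uniform punctured
neighbourhood of `1` (`uniformlyLocallyFree_T1`). It is carried out for a flow `x <• B (σ * t)` with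
`σ ≠ 0`; the values `σ = 1` and `σ = -1` give the positive and the negative statement.

Write a time change as `ψ t x = θ (h x t) x`. If the `ψ`-orbits of `x` and `y` stay close for `t ≥ 0`,
then `y = x <• u` with `u` near `1`, and by connectedness the displacement
`B (-σ h x t) * u * B (σ h y t)` stays near `1` in the group (`mem_of_forall_exists_rsmul_eq`). Its
lower right entry is bounded, so `u` is upper triangular, say with diagonal
`(exp r, exp (-r))`; its upper right entry is bounded, so `h y t - exp (-2 r) * h x t` is bounded. If
`r = 0`, then `y` lies on the orbit of `x`, at small distance, as wanted.

It remains to exclude `r ≠ 0`, and by symmetry `r < 0` (`not_synchronized_of_neg`). Let `Y` be a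
minimal set of the horocycle flow in the `ω`-limit set of `x`. Minimal sets are invariant under the
diagonal group (`IsHoroMinimal.rsmul_diag_mem`): recurrence and local freeness give points
`y <• m ∈ Y` with `m → 1` and lower left entry nonzero, and suitable products `B (-s) * m * B u`
converge to any given diagonal matrix. Passing to the limit along the orbit of `x`, every
`z ∈ Y` has a companion `w ∈ Y` such that `h w t - exp (-2 r) * h z t` is bounded uniformly in `z`
and `t ≥ 0`. For `z` maximizing `h z t` over `Y` this bounds `h z t` independently of `t`, whereas
`h z t → ∞`.
-/

open Filter Topology Set
open scoped RightActions

noncomputable section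

namespace HoroExp

/-! ### Triangular matrices -/

/-- The upper triangular matrix with rows `(exp r, β)` and `(0, exp (-r))`. -/
def upperTri (r β : ℝ) : SL(2, ℝ) :=
  ⟨!![Real.exp r, β; 0, Real.exp (-r)], by simp [Matrix.det_fin_two, ← Real.exp_add]⟩

/-- The lower triangular matrix with rows `(exp r, 0)` and `(c, exp (-r))`. -/
def lowerTri (r c : ℝ) : SL(2, ℝ) :=
  ⟨!![Real.exp r, 0; c, Real.exp (-r)], by simp [Matrix.det_fin_two, ← Real.exp_add]⟩

theorem SL2_ext {m n : SL(2, ℝ)} (h00 : m 0 0 = n 0 0) (h01 : m 0 1 = n 0 1)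
    (h10 : m 1 0 = n 1 0) (h11 : m 1 1 = n 1 1) : m = n := by
  ext i j
  fin_cases i <;> fin_cases j <;> assumption

theorem SL2_mul_apply (m n : SL(2, ℝ)) (i j : Fin 2) :
    (m * n) i j = m i 0 * n 0 j + m i 1 * n 1 j := by
  rw [Matrix.SpecialLinearGroup.coe_mul, Matrix.mul_apply, Fin.sum_univ_two]

section entries

variable (t r β c : ℝ)

@[simp] theorem B_00 : (B t) 0 0 = 1 := rfl
@[simp] theorem B_01 : (B t) 0 1 = t := rfl
@[simp] theorem B_10 : (B t) 1 0 = 0 := rfl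
@[simp] theorem B_11 : (B t) 1 1 = 1 := rfl
@[simp] theorem upperTri_00 : (upperTri r β) 0 0 = Real.exp r := rfl
@[simp] theorem upperTri_01 : (upperTri r β) 0 1 = β := rfl
@[simp] theorem upperTri_10 : (upperTri r β) 1 0 = 0 := rfl
@[simp] theorem upperTri_11 : (upperTri r β) 1 1 = Real.exp (-r) := rfl
@[simp] theorem lowerTri_00 : (lowerTri r c) 0 0 = Real.exp r := rfl
@[simp] theorem lowerTri_01 : (lowerTri r c) 0 1 = 0 := rfl
@[simp] theorem lowerTri_10 : (lowerTri r c) 1 0 = c := rfl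
@[simp] theorem lowerTri_11 : (lowerTri r c) 1 1 = Real.exp (-r) := rfl

end entries

theorem continuous_SL2_mk {X : Type*} [TopologicalSpace X] {f : X → SL(2, ℝ)}
    (h00 : Continuous fun x => (f x) 0 0) (h01 : Continuous fun x => (f x) 0 1)
    (h10 : Continuous fun x => (f x) 1 0) (h11 : Continuous fun x => (f x) 1 1) :
    Continuous f := by
  refine Topology.IsInducing.subtypeVal.continuous_iff.mpr (continuous_matrix fun i j => ?_)
  fin_cases i <;> fin_cases j <;> assumption

theorem continuous_entry (i j : Fin 2) : Continuous fun m : SL(2, ℝ) => m i j :=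
  (continuous_apply_apply i j).comp continuous_subtype_val

theorem continuous_B : Continuous B :=
  continuous_SL2_mk continuous_const continuous_id continuous_const continuous_const

theorem continuous_upperTri : Continuous fun p : ℝ × ℝ => upperTri p.1 p.2 := by
  apply continuous_SL2_mk <;> simp <;> fun_prop

theorem continuous_lowerTri (r : ℝ) : Continuous (lowerTri r) := by
  apply continuous_SL2_mk <;> simp <;> fun_prop

theorem upperTri_zero_left (β : ℝ) : upperTri 0 β = B β := by
  apply SL2_ext <;> simp

theorem upperTri_zero_zero : upperTri 0 0 = 1 := by
  apply SL2_ext <;> simp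

theorem B_mul_B (s t : ℝ) : B s * B t = B (s + t) := by
  apply SL2_ext <;> simp [SL2_mul_apply, add_comm]

theorem B_zero : B 0 = 1 := by
  apply SL2_ext <;> simp

theorem upperTri_mul_upperTri (r β s γ : ℝ) :
    upperTri r β * upperTri s γ =
      upperTri (r + s) (Real.exp r * γ + β * Real.exp (-s)) := by
  apply SL2_ext <;> simp [SL2_mul_apply, Real.exp_add, mul_comm]

theorem lowerTri_zero_right (r : ℝ) : lowerTri r 0 = upperTri r 0 := by
  apply SL2_ext <;> simp

theorem upperTri_mul_B (r β t : ℝ) :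
    upperTri r β * B t = upperTri r (Real.exp r * t + β) := by
  rw [← upperTri_zero_left, upperTri_mul_upperTri]; simp

theorem B_mul_upperTri (r β t : ℝ) :
    B t * upperTri r β = upperTri r (β + t * Real.exp (-r)) := by
  rw [← upperTri_zero_left, upperTri_mul_upperTri]; simp

/-- A matrix with vanishing lower left entry and positive upper left entry is triangular with
exponential diagonal. -/
theorem eq_upperTri {m : SL(2, ℝ)} (h10 : m 1 0 = 0) (h00 : 0 < m 0 0) :
    m = upperTri (Real.log (m 0 0)) (m 0 1) := by
  have hd := det_eq m
  rw [h10, mul_zero, sub_zero] at hd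
  apply SL2_ext
  · simp [Real.exp_log h00]
  · simp
  · simp [h10]
  · rw [upperTri_11, Real.exp_neg, Real.exp_log h00]
    exact eq_inv_of_mul_eq_one_right hd

/-- If the lower left entry of `m` is nonzero, multiplying by unipotent matrices from both sides
makes `m` lower triangular with any prescribed diagonal. -/
theorem exists_B_mul_mul_B_eq_lowerTri (m : SL(2, ℝ)) (hm : m 1 0 ≠ 0) (r : ℝ) :
    ∃ s u : ℝ, m * B u = B s * lowerTri r (m 1 0) := by
  have hd := det_eq m
  have he := (Real.exp_pos r).ne'
  refine ⟨(m 0 0 - Real.exp r) / m 1 0, (Real.exp (-r) - m 1 1) / m 1 0, ?_⟩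
  apply SL2_ext
  · simp [SL2_mul_apply]; field_simp; ring
  · simp [SL2_mul_apply, Real.exp_neg]; field_simp
    linear_combination (-Real.exp r) * hd
  · simp [SL2_mul_apply]
  · simp [SL2_mul_apply]; field_simp; ring

/-! ### Locally free right actions of `SL(2, ℝ)` -/

section Action

variable {X : Type*} [MulAction SL(2, ℝ)ᵐᵒᵖ X]

theorem rsmul_mul (x : X) (m n : SL(2, ℝ)) : x <• (m * n) = x <• m <• n := by
  rw [MulOpposite.op_mul, mul_smul]

theorem rsmul_one (x : X) : x <• (1 : SL(2, ℝ)) = x := by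
  rw [MulOpposite.op_one, one_smul]

theorem eq_rsmul_inv {x y : X} {m : SL(2, ℝ)} (h : x <• m = y) : x = y <• m⁻¹ := by
  rw [← h, ← rsmul_mul, mul_inv_cancel, rsmul_one]

variable (X) in
/-- All stabilizers meet a common neighbourhood of `1` only in `1`. -/
def UniformlyLocallyFree : Prop :=
  ∃ W ∈ 𝓝 (1 : SL(2, ℝ)), ∀ x : X, ∀ m ∈ W, x <• m = x → m = 1

/-- Stabilizers contain no upper triangular matrix with diagonal close to `1`, however large its
upper right entry is: conjugation by a diagonal matrix, which replaces `x` by another point, makes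
that entry small. -/
theorem UniformlyLocallyFree.upperTri (h : UniformlyLocallyFree X) :
    ∃ η > 0, ∀ (x : X) (r β : ℝ), |r| < η → x <• upperTri r β = x → r = 0 ∧ β = 0 := by
  obtain ⟨W, hW, hfree⟩ := h
  have hc : Tendsto (fun p : ℝ × ℝ => HoroExp.upperTri p.1 p.2) (𝓝 (0, 0)) (𝓝 1) := by
    have := continuous_upperTri.tendsto (0, 0)
    simpa only [upperTri_zero_zero] using this
  obtain ⟨η, hη, hball⟩ := Metric.eventually_nhds_iff.mp (hc.eventually hW)
  refine ⟨η, hη, fun x r β hr hx => ?_⟩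
  obtain ⟨s, hs⟩ : ∃ s : ℝ, |β * Real.exp (-s)| < η := by
    have : Tendsto (fun s : ℝ => |β * Real.exp (-s)|) atTop (𝓝 0) := by
      simpa using (Real.tendsto_exp_neg_atTop_nhds_zero.const_mul β).abs
    exact (this.eventually (gt_mem_nhds hη)).exists
  have hconj : HoroExp.upperTri r β * HoroExp.upperTri (s / 2) 0 =
      HoroExp.upperTri (s / 2) 0 * HoroExp.upperTri r (β * Real.exp (-s)) := by
    rw [upperTri_mul_upperTri, upperTri_mul_upperTri, add_comm r]
    congr 1
    have : Real.exp (-s) = Real.exp (-(s / 2)) * Real.exp (-(s / 2)) := by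
      rw [← Real.exp_add]; ring_nf
    rw [this, Real.exp_neg]
    field_simp
    ring
  have hfix : (x <• HoroExp.upperTri (s / 2) 0) <• HoroExp.upperTri r (β * Real.exp (-s)) =
      x <• HoroExp.upperTri (s / 2) 0 := by
    rw [← rsmul_mul, ← hconj, rsmul_mul, hx]
  have hone := hfree _ _ (hball (y := (r, β * Real.exp (-s)))
    (by simpa [Prod.dist_eq] using ⟨hr, by simpa [abs_mul] using hs⟩)) hfix
  have h00 := congrArg (fun m : SL(2, ℝ) => m 0 0) hone
  have h01 := congrArg (fun m : SL(2, ℝ) => m 0 1) hone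
  simp at h00 h01
  exact ⟨h00, h01⟩

theorem UniformlyLocallyFree.eq_zero (h : UniformlyLocallyFree X) {x : X} {t : ℝ}
    (hx : x <• B t = x) : t = 0 := by
  obtain ⟨η, hη, hη'⟩ := h.upperTri
  exact (hη' x 0 t (by simpa) (by rwa [upperTri_zero_left])).2

variable [TopologicalSpace X]

variable (X) in
/-- All orbit maps `m ↦ x <• m` are open at `1`. -/
def OpenOrbitMaps : Prop :=
  ∀ x : X, ∀ U ∈ 𝓝 (1 : SL(2, ℝ)), (fun m : SL(2, ℝ) => x <• m) '' U ∈ 𝓝 x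

theorem continuous_rsmul [ContinuousSMul SL(2, ℝ)ᵐᵒᵖ X] {Z : Type*} [TopologicalSpace Z]
    {f : Z → X} {g : Z → SL(2, ℝ)} (hf : Continuous f) (hg : Continuous g) :
    Continuous fun z => f z <• g z :=
  (MulOpposite.continuous_op.comp hg).smul hf

/-! ### Minimal sets of the horocycle flow -/

/-- `Y` is a minimal set of the right action of the unipotent matrices `B t`: a nonempty closed
invariant set without smaller nonempty closed invariant subsets. -/
structure IsHoroMinimal (Y : Set X) : Prop where
  isClosed : IsClosed Y
  nonempty : Y.Nonempty
  invariant : ∀ y ∈ Y, ∀ t, y <• B t ∈ Y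
  minimal : ∀ Z ⊆ Y, IsClosed Z → Z.Nonempty → (∀ z ∈ Z, ∀ t, z <• B t ∈ Z) → Z = Y

theorem exists_isHoroMinimal_subset [CompactSpace X] {A : Set X} (hA : IsClosed A)
    (hne : A.Nonempty) (hinv : ∀ y ∈ A, ∀ t, y <• B t ∈ A) : ∃ Y ⊆ A, IsHoroMinimal Y := by
  let P : Set (Set X) := {Z | IsClosed Z ∧ Z.Nonempty ∧ ∀ z ∈ Z, ∀ t, z <• B t ∈ Z}
  obtain ⟨Y, hYA, hY⟩ := zorn_superset_nonempty P (fun C hC hchain hCne => by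
    refine ⟨⋂₀ C, ⟨isClosed_sInter fun Z hZ => (hC hZ).1, ?_, fun z hz t Z hZ =>
      (hC hZ).2.2 z (hz Z hZ) t⟩, fun Z hZ => sInter_subset_of_mem hZ⟩
    have := hCne.to_subtype
    refine IsCompact.nonempty_sInter_of_directed_nonempty_isCompact_isClosed
      (fun Z hZ Z' hZ' => ?_) (fun Z hZ => (hC hZ).2.1) (fun Z hZ => (hC hZ).1.isCompact)
      (fun Z hZ => (hC hZ).1)
    rcases hchain.total hZ hZ' with h | h
    · exact ⟨Z, hZ, subset_rfl, h⟩
    · exact ⟨Z', hZ', h, subset_rfl⟩) A ⟨hA, hne, hinv⟩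
  exact ⟨Y, hYA, hY.prop.1, hY.prop.2.1, hY.prop.2.2, fun Z hZY h1 h2 h3 =>
    hZY.antisymm (hY.le_of_le ⟨h1, h2, h3⟩ hZY)⟩

variable [ContinuousSMul SL(2, ℝ)ᵐᵒᵖ X]

variable (X) in
/-- The action of the unipotent matrices `B t` as a flow. -/
def unipotentFlow : Flow ℝ X where
  toFun t x := x <• B t
  cont' := continuous_rsmul continuous_snd (continuous_B.comp continuous_fst)
  map_add' s t x := by rw [← rsmul_mul, B_mul_B, add_comm]
  map_zero' x := by rw [B_zero, rsmul_one]

/-- Points of a minimal set are recurrent. -/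
theorem IsHoroMinimal.recurrent [CompactSpace X] {Y : Set X} (hY : IsHoroMinimal Y) {y : X}
    (hy : y ∈ Y) {U : Set X} (hU : U ∈ 𝓝 y) : ∃ t : ℝ, 1 ≤ t ∧ y <• B t ∈ U := by
  have hω : omegaLimit atTop (unipotentFlow X) {y} = Y := by
    refine hY.minimal _ ?_ (isClosed_omegaLimit _ _ _)
      (nonempty_omegaLimit _ _ _ (singleton_nonempty y)) fun z hz t =>
        (unipotentFlow X).isInvariant_omegaLimit _ _
          (fun s => tendsto_atTop_add_const_left _ s tendsto_id) t hz
    refine (omegaLimit_subset_closure_image2 _ _ _ univ_mem).trans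
      (closure_minimal ?_ hY.isClosed)
    rintro _ ⟨t, -, x, rfl, rfl⟩
    exact hY.invariant x hy t
  rw [← hω, mem_omegaLimit_singleton_iff_mapClusterPt, mapClusterPt_iff_frequently] at hy
  obtain ⟨t, htU, ht⟩ := ((hy U hU).and_eventually (eventually_ge_atTop 1)).exists
  exact ⟨t, ht, htU⟩

/-- A minimal set returns to any of its points `y` along directions transverse to the upper
triangular group: recurrence yields `y <• B t` close to `y`, and local freeness excludes that the
displacement is upper triangular. -/
theorem IsHoroMinimal.exists_transverse_return [CompactSpace X] (hfree : UniformlyLocallyFree X)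
    (hopen : OpenOrbitMaps X)
    {Y : Set X} (hY : IsHoroMinimal Y) {y : X} (hy : y ∈ Y) {c : ℝ} (hc : 0 < c) :
    ∃ m : SL(2, ℝ), y <• m ∈ Y ∧ m 1 0 ≠ 0 ∧ |m 1 0| < c := by
  obtain ⟨η, hη, hfix⟩ := hfree.upperTri
  have h00 : ∀ᶠ m in 𝓝 (1 : SL(2, ℝ)), 0 < m 0 0 :=
    (continuous_entry 0 0).continuousAt.eventually (lt_mem_nhds (by simp))
  have hlog : ∀ᶠ m in 𝓝 (1 : SL(2, ℝ)), |Real.log (m 0 0)| < η := by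
    have : ContinuousAt (fun m : SL(2, ℝ) => |Real.log (m 0 0)|) 1 :=
      ((continuous_entry 0 0).continuousAt.log (by simp)).abs
    exact this.eventually (gt_mem_nhds (by simpa))
  have h01 : ∀ᶠ m in 𝓝 (1 : SL(2, ℝ)), m 0 1 < 1 :=
    (continuous_entry 0 1).continuousAt.eventually (gt_mem_nhds (by simp))
  have h10 : ∀ᶠ m in 𝓝 (1 : SL(2, ℝ)), |m 1 0| < c :=
    (continuous_entry 1 0).abs.continuousAt.eventually (gt_mem_nhds (by simpa))
  obtain ⟨t, ht, m, ⟨hm00, hmlog, hm01, hm10⟩, hm⟩ :=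
    hY.recurrent hy (hopen y _ (h00.and (hlog.and (h01.and h10))))
  refine ⟨m, ?_, fun h => ?_, hm10⟩
  · rw [show y <• m = y <• B t from hm]; exact hY.invariant y hy t
  · have h1 : y <• (m * B (-t)) = y := by
      rw [rsmul_mul, show y <• m = y <• B t from hm, ← rsmul_mul, B_mul_B, add_neg_cancel, B_zero,
        rsmul_one]
    rw [eq_upperTri h hm00, upperTri_mul_B] at h1
    obtain ⟨h2, h3⟩ := hfix _ _ _ hmlog h1
    rw [h2, Real.exp_zero] at h3
    linarith

/-- Minimal sets of the horocycle flow on a compact space are invariant under the diagonal group.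
Transverse returns `y <• m` with `m → 1` are moved by the horocycle flow to pairs of points of `Y`
that differ by `lowerTri r c` with `c → 0`, for any prescribed `r`. -/
theorem IsHoroMinimal.rsmul_diag_mem [CompactSpace X] (hfree : UniformlyLocallyFree X)
    (hopen : OpenOrbitMaps X)
    {Y : Set X} (hY : IsHoroMinimal Y) (r : ℝ) {z : X} (hz : z ∈ Y) :
    z <• upperTri r 0 ∈ Y := by
  have hcl : IsClosed {c : ℝ | ∃ z : X, z ∈ Y ∧ z <• lowerTri r c ∈ Y} := by
    have h1 : IsClosed {p : X × ℝ | p.1 ∈ Y ∧ p.1 <• lowerTri r p.2 ∈ Y} :=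
      (hY.isClosed.preimage continuous_fst).inter (hY.isClosed.preimage
        (continuous_rsmul continuous_fst ((continuous_lowerTri r).comp continuous_snd)))
    convert isClosedMap_snd_of_compactSpace _ h1 using 1
    ext c
    simp
  obtain ⟨z₀, hz₀, hz₀'⟩ : (0 : ℝ) ∈ {c : ℝ | ∃ z : X, z ∈ Y ∧ z <• lowerTri r c ∈ Y} := by
    rw [← hcl.closure_eq, Metric.mem_closure_iff]
    intro ε hε
    obtain ⟨y, hy⟩ := hY.nonempty
    obtain ⟨m, hmY, hm0, hmε⟩ := hY.exists_transverse_return hfree hopen hy hε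
    obtain ⟨s, u, hsu⟩ := exists_B_mul_mul_B_eq_lowerTri m hm0 r
    refine ⟨m 1 0, ⟨y <• B s, hY.invariant y hy s, ?_⟩, by simpa using hmε⟩
    rw [← rsmul_mul, ← hsu, rsmul_mul]
    exact hY.invariant _ hmY u
  rw [lowerTri_zero_right] at hz₀'
  have hZ : Y ∩ {z | z <• upperTri r 0 ∈ Y} = Y := by
    refine hY.minimal _ inter_subset_left (hY.isClosed.inter
      (hY.isClosed.preimage (continuous_rsmul continuous_id continuous_const)))
      ⟨z₀, hz₀, hz₀'⟩ fun w hw t => ⟨hY.invariant w hw.1 t, ?_⟩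
    have h1 : B t * upperTri r 0 = upperTri r 0 * B (t * Real.exp (-r) * Real.exp (-r)) := by
      rw [B_mul_upperTri, upperTri_mul_B, Real.exp_neg]
      congr 1
      field_simp
      ring
    change w <• B t <• upperTri r 0 ∈ Y
    rw [← rsmul_mul, h1, rsmul_mul]
    exact hY.invariant _ hw.2 _
  exact (hZ.ge hz).2

end Action

/-! ### Time changes of flows without periodic points -/

section TimeChange

variable {X : Type*} [TopologicalSpace X]

/-- `h x` is the reparametrization of the orbit of `x` in a time change `ψ` of a flow `θ` all of
whose orbits are injective. -/
structure IsReparam (ψ θ : Flow ℝ X) (h : X → ℝ → ℝ) : Prop where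
  injective : ∀ x, Function.Injective fun t => θ t x
  continuous_right : ∀ x, Continuous (h x)
  strictMono : ∀ x, StrictMono (h x)
  map_zero : ∀ x, h x 0 = 0
  apply_eq : ∀ x t, ψ t x = θ (h x t) x
  surjective : ∀ x, Function.Surjective (h x)

theorem IsTimeChange.exists_isReparam {ψ θ : Flow ℝ X} (H : IsTimeChange ψ θ)
    (hinj : ∀ x, Function.Injective fun t => θ t x) : ∃ h, IsReparam ψ θ h := by
  choose horb h h1 h2 h3 h4 using H
  refine ⟨h, hinj, h1, h2, h3, h4, fun x s => ?_⟩
  obtain ⟨t, ht⟩ : θ s x ∈ ψ.orbit x := horb x ▸ θ.mem_orbit x s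
  exact ⟨t, hinj x ((h4 x t).symm.trans ht)⟩

namespace IsReparam

variable {ψ θ : Flow ℝ X} {h : X → ℝ → ℝ}

theorem add (H : IsReparam ψ θ h) (x : X) (s t : ℝ) : h x (s + t) = h x s + h (ψ s x) t := by
  apply H.injective x
  change θ _ x = θ _ x
  rw [← H.apply_eq, add_comm s, ψ.map_add, H.apply_eq (ψ s x), H.apply_eq x s, ← θ.map_add,
    add_comm]

theorem nonneg (H : IsReparam ψ θ h) (x : X) {t : ℝ} (ht : 0 ≤ t) : 0 ≤ h x t :=
  H.map_zero x ▸ (H.strictMono x).monotone ht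

theorem tendsto_atTop (H : IsReparam ψ θ h) (x : X) : Tendsto (h x) atTop atTop :=
  (H.strictMono x).monotone.tendsto_atTop_atTop fun b => (H.surjective x b).imp fun _ => ge_of_eq

/-- The conditions `m ≤ h x t` and `h x t ≤ m` both say that the orbit segments of `ψ` and `θ`
of certain compact ranges of times meet, hence are closed in `x`. -/
theorem continuous_left [T2Space X] (H : IsReparam ψ θ h) {t : ℝ} (ht : 0 ≤ t) :
    Continuous fun x => h x t := by
  have key : ∀ (T : ℝ) (f g : ℝ × X → X), Continuous f → Continuous g →
      IsClosed {x | ∃ s ∈ Icc 0 T, f (s, x) = g (s, x)} := by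
    intro T f g hf hg
    have hcl : IsClosed {p : Icc (0 : ℝ) T × X | f (p.1, p.2) = g (p.1, p.2)} :=
      isClosed_eq (by fun_prop) (by fun_prop)
    convert isClosedMap_snd_of_compactSpace _ hcl using 1
    ext x
    simp
  rw [OrderTopology.continuous_iff]
  intro m
  rcases lt_or_ge m 0 with hm | hm
  · constructor
    · convert isOpen_univ
      ext x
      simpa using hm.trans_le (H.nonneg x ht)
    · convert isOpen_empty
      ext x
      simpa using hm.le.trans (H.nonneg x ht)
  · constructor
    · rw [← isClosed_compl_iff]
      convert key m (fun p => ψ t p.2) (fun p => θ p.1 p.2) (by fun_prop) (by fun_prop) using 1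
      ext x
      simp only [mem_compl_iff, mem_preimage, mem_Ioi, not_lt, mem_ofPred_eq]
      constructor
      · exact fun hx => ⟨h x t, ⟨H.nonneg x ht, hx⟩, H.apply_eq x t⟩
      · rintro ⟨s, hs, hsx⟩
        rw [H.apply_eq] at hsx
        rw [H.injective x hsx]
        exact hs.2
    · rw [← isClosed_compl_iff]
      convert key t (fun p => ψ p.1 p.2) (fun p => θ m p.2) (by fun_prop) (by fun_prop) using 1
      ext x
      simp only [mem_compl_iff, mem_preimage, mem_Iio, not_lt, mem_ofPred_eq]
      constructor
      · intro hx
        obtain ⟨s, hs⟩ := H.surjective x m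
        refine ⟨s, ⟨?_, ?_⟩, by rw [H.apply_eq, hs]⟩
        · rwa [← (H.strictMono x).le_iff_le, hs, H.map_zero]
        · rwa [← (H.strictMono x).le_iff_le, hs]
      · rintro ⟨s, hs, hsx⟩
        rw [H.apply_eq] at hsx
        rw [← H.injective x hsx]
        exact (H.strictMono x).monotone hs.2

/-- On a compact space, a time of size at least `ε` for `ψ` corresponds to a time for `θ` that is
uniformly bounded away from zero. -/
theorem exists_le_abs [CompactSpace X] [T2Space X] (H : IsReparam ψ θ h) {ε : ℝ} (hε : 0 < ε) :
    ∃ η > 0, ∀ x t, |h x t| < η → |t| < ε := by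
  have hpos : ∀ x, 0 < h x ε := fun x => H.map_zero x ▸ H.strictMono x hε
  obtain ⟨η, hη, hle⟩ : ∃ η > 0, ∀ x, η ≤ h x ε := by
    rcases isEmpty_or_nonempty X with hX | hX
    · exact ⟨1, one_pos, fun x => hX.elim x⟩
    · obtain ⟨x₀, -, hx₀⟩ := isCompact_univ.exists_isMinOn univ_nonempty
        (H.continuous_left hε.le).continuousOn
      exact ⟨h x₀ ε, hpos x₀, fun x => hx₀ (mem_univ x)⟩
  refine ⟨η, hη, fun x t ht => ?_⟩
  rw [abs_lt] at ht ⊢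
  constructor
  · by_contra! hlt
    have h1 := H.add x (-ε) ε
    rw [neg_add_cancel, H.map_zero] at h1
    linarith [hle (ψ (-ε) x), (H.strictMono x).monotone hlt]
  · by_contra! hlt
    linarith [hle x, (H.strictMono x).monotone hlt]

end IsReparam

end TimeChange

/-! ### Synchronized orbits -/

section Synchronized

variable {X : Type*} [TopologicalSpace X] [CompactSpace X] [T2Space X] [MulAction SL(2, ℝ)ᵐᵒᵖ X]
  [ContinuousSMul SL(2, ℝ)ᵐᵒᵖ X] {ψ θ : Flow ℝ X} {h : X → ℝ → ℝ} {σ : ℝ}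

/-- If the orbits of `x` and `x <• upperTri r β` stay at bounded distance, this passes to a minimal
set `Y` in the `ω`-limit set of `x`, as `Y` is invariant under upper triangular matrices. -/
theorem exists_minimal_synchronized (hfree : UniformlyLocallyFree X)
    (hopen : OpenOrbitMaps X)
    (hσ : σ ≠ 0) (hθ : ∀ t x, θ t x = x <• B (σ * t)) (H : IsReparam ψ θ h) {x y : X}
    {r β C : ℝ} (hy : y = x <• upperTri r β)
    (hC : ∀ t, 0 ≤ t → |h y t - Real.exp (-(2 * r)) * h x t| ≤ C) :
    ∃ Y : Set X, IsHoroMinimal Y ∧ ∀ z ∈ Y, ∃ w ∈ Y, ∀ t, 0 ≤ t →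
      |h w t - Real.exp (-(2 * r)) * h z t| ≤ 2 * C := by
  obtain ⟨l, hl⟩ : ∃ l, l = Real.exp (-(2 * r)) := ⟨_, rfl⟩
  rw [← hl] at hC ⊢
  obtain ⟨Y, hYω, hY⟩ := exists_isHoroMinimal_subset (isClosed_omegaLimit atTop ψ {x})
    (nonempty_omegaLimit atTop ψ {x} (singleton_nonempty x)) (fun z hz t => by
      obtain ⟨s, hs⟩ := H.surjective z (t / σ)
      have h1 : z <• B t = ψ s z := by
        rw [H.apply_eq, hs, hθ, mul_div_cancel₀ _ hσ]
      rw [h1]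
      exact ψ.isInvariant_omegaLimit _ _
        (fun s => tendsto_atTop_add_const_left _ s tendsto_id) s hz)
  refine ⟨Y, hY, fun z hz => ?_⟩
  have hcl := hYω hz
  rw [mem_omegaLimit_singleton_iff_mapClusterPt, mapClusterPt_iff_ultrafilter] at hcl
  obtain ⟨F, hF, hFz⟩ := hcl
  -- the displacement between the two orbits at time `t`
  obtain ⟨ρ, hρ_def, hρ⟩ : ∃ ρ : ℝ → ℝ, (∀ t, ρ t = Real.exp r * (σ * (h y t - l * h x t)) + β) ∧
      ∀ t, ψ t y = ψ t x <• upperTri r (ρ t) := by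
    refine ⟨_, fun _ => rfl, fun t => ?_⟩
    have hy' : ∀ m : SL(2, ℝ), y <• m = x <• (upperTri r β * m) := fun m => by
      rw [hy, rsmul_mul]
    rw [H.apply_eq, H.apply_eq, hθ, hθ, hy', ← rsmul_mul, B_mul_upperTri, upperTri_mul_B]
    congr 3
    have : Real.exp (-r) = Real.exp r * l := by rw [hl, ← Real.exp_add]; ring_nf
    rw [this]
    ring
  have hpos : ∀ᶠ t in (F : Filter ℝ), 0 ≤ t := hF (eventually_ge_atTop 0)
  obtain ⟨ρ₀, -, hρ₀⟩ : ∃ ρ₀ ∈ Metric.closedBall (0 : ℝ) (Real.exp r * (|σ| * C) + |β|),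
      Tendsto ρ F (𝓝 ρ₀) := by
    refine (isCompact_closedBall (0 : ℝ) _).ultrafilter_le_nhds (F.map ρ) ?_
    rw [Ultrafilter.coe_map, le_principal_iff, mem_map]
    filter_upwards [hpos] with t ht
    rw [mem_preimage, mem_closedBall_zero_iff, Real.norm_eq_abs, hρ_def]
    refine (abs_add_le _ _).trans ?_
    rw [abs_mul, abs_mul, Real.abs_exp]
    gcongr
    exact hC t ht
  refine ⟨z <• upperTri r ρ₀, ?_, fun t ht => ?_⟩
  · have h1 := hY.invariant _ (hY.rsmul_diag_mem hfree hopen r hz) (Real.exp (-r) * ρ₀)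
    rw [← rsmul_mul, upperTri_mul_B, ← mul_assoc, ← Real.exp_add] at h1
    simpa using h1
  have hw : Tendsto (fun s => ψ s y) F (𝓝 (z <• upperTri r ρ₀)) := by
    have hcont : Continuous fun p : X × ℝ => p.1 <• upperTri r p.2 :=
      continuous_rsmul continuous_fst
        (continuous_upperTri.comp (continuous_const.prodMk continuous_snd))
    have h1 : Tendsto (fun t => (ψ t x, ρ t)) F (𝓝 (z, ρ₀)) := hFz.prodMk_nhds hρ₀
    have h2 := (hcont.tendsto (z, ρ₀)).comp h1
    exact h2.congr fun t => (hρ t).symm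
  have hlim : Tendsto (fun s => |h (ψ s y) t - l * h (ψ s x) t|) F
      (𝓝 |h (z <• upperTri r ρ₀) t - l * h z t|) := by
    have h1 := ((H.continuous_left ht).tendsto (z <• upperTri r ρ₀)).comp hw
    have h2 := ((H.continuous_left ht).tendsto z).comp hFz
    exact (h1.sub (h2.const_mul l)).abs
  refine le_of_tendsto hlim ?_
  filter_upwards [hpos] with s hs
  have h1 := abs_le.mp (hC s hs)
  have h2 := abs_le.mp (hC (s + t) (add_nonneg hs ht))
  rw [H.add, H.add] at h2
  rw [abs_le]
  constructor <;> linarith [h1.1, h1.2, h2.1, h2.2]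

/-- Two orbits on a common stable leaf, at nonzero distance in the diagonal direction, cannot be
synchronized by a time change. In a minimal set invariant under the diagonal group, synchronization
would multiply the largest value of `h z t`, `z ∈ Y`, by the factor `exp (-2 r) > 1`, up to a bounded
error, so this largest value would be bounded in `t`. -/
theorem not_synchronized_of_neg (hfree : UniformlyLocallyFree X)
    (hopen : OpenOrbitMaps X)
    (hσ : σ ≠ 0) (hθ : ∀ t x, θ t x = x <• B (σ * t)) (H : IsReparam ψ θ h) (x : X) {r β C : ℝ}
    (hr : r < 0)
    (hC : ∀ t, 0 ≤ t → |h (x <• upperTri r β) t - Real.exp (-(2 * r)) * h x t| ≤ C) : False := by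
  obtain ⟨Y, hY, hsync⟩ := exists_minimal_synchronized hfree hopen hσ hθ H rfl hC
  have hl : 1 < Real.exp (-(2 * r)) := Real.one_lt_exp_iff.mpr (by linarith)
  set l := Real.exp (-(2 * r))
  have hbdd : ∀ z ∈ Y, ∀ t, 0 ≤ t → h z t ≤ 2 * C / (l - 1) := by
    intro z hz t ht
    obtain ⟨z₀, hz₀, hmax⟩ := hY.isClosed.isCompact.exists_isMaxOn ⟨z, hz⟩
      (H.continuous_left ht).continuousOn
    obtain ⟨w, hw, hwz⟩ := hsync z₀ hz₀
    have h1 := (abs_le.mp (hwz t ht)).1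
    have h2 : h w t ≤ h z₀ t := hmax hw
    have h3 : h z t ≤ h z₀ t := hmax hz
    refine h3.trans ?_
    rw [le_div_iff₀ (by linarith)]
    linarith
  obtain ⟨z, hz⟩ := hY.nonempty
  obtain ⟨t, ht, ht0⟩ := (((H.tendsto_atTop z).eventually
    (eventually_gt_atTop (2 * C / (l - 1)))).and (eventually_ge_atTop 0)).exists
  exact (hbdd z hz t ht0).not_gt ht

theorem eq_zero_of_synchronized (hfree : UniformlyLocallyFree X)
    (hopen : OpenOrbitMaps X)
    (hσ : σ ≠ 0) (hθ : ∀ t x, θ t x = x <• B (σ * t)) (H : IsReparam ψ θ h) (x : X) {r β C : ℝ}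
    (hC : ∀ t, 0 ≤ t → |h (x <• upperTri r β) t - Real.exp (-(2 * r)) * h x t| ≤ C) : r = 0 := by
  rcases lt_trichotomy r 0 with hr | hr | hr
  · exact (not_synchronized_of_neg hfree hopen hσ hθ H x hr hC).elim
  · exact hr
  · have hx : x <• upperTri r β <• upperTri (-r) (-β) = x := by
      rw [← rsmul_mul, upperTri_mul_upperTri]
      have : Real.exp r * -β + β * Real.exp (- -r) = 0 := by rw [neg_neg]; ring
      rw [this, add_neg_cancel, upperTri_zero_zero, rsmul_one]
    refine (not_synchronized_of_neg (β := -β) (C := Real.exp (2 * r) * C) hfree hopen hσ hθ H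
      (x <• upperTri r β) (neg_lt_zero.mpr hr) fun t ht => ?_).elim
    have h1 : h x t - Real.exp (2 * r) * h (x <• upperTri r β) t =
        -(Real.exp (2 * r) * (h (x <• upperTri r β) t - Real.exp (-(2 * r)) * h x t)) := by
      rw [Real.exp_neg]
      field_simp
      ring
    rw [hx, mul_neg, neg_neg, h1, abs_neg, abs_mul, Real.abs_exp]
    gcongr
    exact hC t ht

end Synchronized

/-! ### Expansiveness of time changes for locally free actions -/

section Expansive

variable {X : Type*} [MulAction SL(2, ℝ)ᵐᵒᵖ X]

/-- When all orbit maps are open, uniformly close points of a compact space differ by a small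
element of the group. -/
theorem exists_rsmul_eq_of_dist_lt [MetricSpace X] [CompactSpace X]
    (hopen : OpenOrbitMaps X)
    {U : Set SL(2, ℝ)} (hU : U ∈ 𝓝 1) :
    ∃ δ > 0, ∀ x y : X, dist x y < δ → ∃ u ∈ U, y = x <• u := by
  have hdiv : Tendsto (fun p : SL(2, ℝ) × SL(2, ℝ) => p.1⁻¹ * p.2) (𝓝 1 ×ˢ 𝓝 1) (𝓝 1) := by
    rw [← nhds_prod_eq]
    have h1 : Continuous fun p : SL(2, ℝ) × SL(2, ℝ) => p.1⁻¹ * p.2 := by fun_prop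
    simpa using h1.tendsto (1, 1)
  obtain ⟨V, hV, hVU⟩ := (eventually_prod_self_iff' (r := fun p => p.1⁻¹ * p.2 ∈ U)).mp
    (hdiv.eventually hU)
  obtain ⟨δ, hδ, hball⟩ := lebesgue_number_lemma_of_metric (s := univ) isCompact_univ
    (c := fun x : X => interior ((fun m : SL(2, ℝ) => x <• m) '' V)) (fun x => isOpen_interior)
    (fun x _ => mem_iUnion.mpr ⟨x, mem_interior_iff_mem_nhds.mpr (hopen x V hV)⟩)
  refine ⟨δ, hδ, fun x y hxy => ?_⟩
  obtain ⟨z, hz⟩ := hball x (mem_univ x)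
  obtain ⟨v, hv, hvx⟩ := interior_subset (hz (Metric.mem_ball_self hδ))
  obtain ⟨w, hw, hwy⟩ := interior_subset (hz (Metric.mem_ball'.mpr hxy))
  have hvx' : z <• v = x := hvx
  have hwy' : z <• w = y := hwy
  exact ⟨v⁻¹ * w, hVU v hv w hw, by rw [rsmul_mul, ← eq_rsmul_inv hvx', hwy']⟩

/-- A continuous path of displacements which starts in a small neighbourhood `U` of `1` and is, at
each time, congruent to an element of `U` modulo a stabilizer, stays in `U`. -/
theorem mem_of_forall_exists_rsmul_eq {W U : Set SL(2, ℝ)}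
    (hW : ∀ x : X, ∀ m ∈ W, x <• m = x → m = 1) (hU : IsOpen U)
    (hUW : ∀ u ∈ U, ∀ v ∈ closure U, u * v⁻¹ ∈ W) {m : ℝ → SL(2, ℝ)} (hm : Continuous m)
    (hm0 : m 0 ∈ U) {p : ℝ → X} (hp : ∀ t, 0 ≤ t → ∃ u ∈ U, p t <• m t = p t <• u) {t : ℝ}
    (ht : 0 ≤ t) : m t ∈ U := by
  refine isPreconnected_Ici.subset_of_closure_inter_subset (s := Ici (0 : ℝ)) (u := m ⁻¹' U)
    (hU.preimage hm) ⟨0, self_mem_Ici, hm0⟩ ?_ ht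
  rintro s ⟨hs, hs0⟩
  obtain ⟨u, hu, hus⟩ := hp s hs0
  have h1 : u * (m s)⁻¹ = 1 :=
    hW (p s) _ (hUW u hu _ (hm.closure_preimage_subset U hs))
      (by rw [rsmul_mul]; exact (eq_rsmul_inv hus).symm)
  rwa [mem_preimage, ← mul_inv_eq_one.mp h1]

/-- A neighbourhood of `1` contains an open one whose quotients with its closure stay in it. -/
theorem exists_open_nhds_one_mul_inv_closure {W N : Set SL(2, ℝ)} (hW : W ∈ 𝓝 1) (hN : N ∈ 𝓝 1) :
    ∃ U ⊆ N, IsOpen U ∧ 1 ∈ U ∧ ∀ u ∈ U, ∀ v ∈ closure U, u * v⁻¹ ∈ W := by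
  have hdiv : Tendsto (fun p : SL(2, ℝ) × SL(2, ℝ) => p.1 * p.2⁻¹) (𝓝 1 ×ˢ 𝓝 1) (𝓝 1) := by
    rw [← nhds_prod_eq]
    have h1 : Continuous fun p : SL(2, ℝ) × SL(2, ℝ) => p.1 * p.2⁻¹ := by fun_prop
    simpa using h1.tendsto (1, 1)
  obtain ⟨V, hV, hVW⟩ := (eventually_prod_self_iff' (r := fun p => p.1 * p.2⁻¹ ∈ W)).mp
    (hdiv.eventually hW)
  obtain ⟨F, hF, hFcl, hFV⟩ := exists_mem_nhds_isClosed_subset (inter_mem hV hN)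
  refine ⟨interior F, interior_subset.trans (hFV.trans inter_subset_right), isOpen_interior,
    mem_interior_iff_mem_nhds.mpr hF, fun u hu v hv => hVW u (hFV (interior_subset hu)).1 v ?_⟩
  exact (hFV (closure_minimal interior_subset hFcl hv)).1

theorem isPositiveKinematicExpansive_of_isTimeChange [MetricSpace X] [CompactSpace X]
    [ContinuousSMul SL(2, ℝ)ᵐᵒᵖ X] (hfree : UniformlyLocallyFree X)
    (hopen : OpenOrbitMaps X)
    {ψ θ : Flow ℝ X} {σ : ℝ} (hσ : σ ≠ 0) (hθ : ∀ t x, θ t x = x <• B (σ * t))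
    (hψ : IsTimeChange ψ θ) : IsPositiveKinematicExpansive dist ψ := by
  intro ε hε
  obtain ⟨h, H⟩ := hψ.exists_isReparam fun x s t hst => by
    have h1 : x <• B (σ * s) = x <• B (σ * t) := by simpa only [hθ] using hst
    have h2 : x <• B (σ * (s - t)) = x := by
      rw [show σ * (s - t) = σ * s + -(σ * t) by ring, ← B_mul_B, rsmul_mul, h1, ← rsmul_mul,
        B_mul_B, add_neg_cancel, B_zero, rsmul_one]
    exact sub_eq_zero.mp ((mul_eq_zero.mp (hfree.eq_zero h2)).resolve_left hσ)
  obtain ⟨η, hη, hηε⟩ := H.exists_le_abs hε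
  have ⟨W, hW, hWfree⟩ := hfree
  have h00 : ∀ᶠ m in 𝓝 (1 : SL(2, ℝ)), 0 < m 0 0 :=
    (continuous_entry 0 0).continuousAt.eventually (lt_mem_nhds (by simp))
  have h01 : ∀ᶠ m in 𝓝 (1 : SL(2, ℝ)), |m 0 1| < η * |σ| :=
    (continuous_entry 0 1).abs.continuousAt.eventually
      (gt_mem_nhds (by simpa using mul_pos hη (abs_pos.mpr hσ)))
  have h11 : ∀ᶠ m in 𝓝 (1 : SL(2, ℝ)), |m 1 1| < 2 :=
    (continuous_entry 1 1).abs.continuousAt.eventually (gt_mem_nhds (by simp))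
  obtain ⟨U, hUN, hUo, hU1, hUW⟩ :=
    exists_open_nhds_one_mul_inv_closure hW (h00.and (h01.and h11))
  obtain ⟨δ, hδ, hclose⟩ := exists_rsmul_eq_of_dist_lt hopen (hUo.mem_nhds hU1)
  refine ⟨δ, hδ, fun x y hxy => ?_⟩
  obtain ⟨u, hu, rfl⟩ := hclose x y (by simpa using hxy 0 le_rfl)
  set y := x <• u with hy
  -- the displacement between the two orbits at time `t`, lifted to the group
  have hmU : ∀ t, 0 ≤ t → B (-(σ * h x t)) * u * B (σ * h y t) ∈ U := by
    intro t ht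
    refine mem_of_forall_exists_rsmul_eq (p := fun t => ψ t x)
      (m := fun t => B (-(σ * h x t)) * u * B (σ * h y t)) hWfree hUo hUW ?_ ?_ (fun t ht => ?_) ht
    · have hx := H.continuous_right x
      have hy := H.continuous_right y
      exact ((continuous_B.comp (by fun_prop)).mul continuous_const).mul
        (continuous_B.comp (by fun_prop))
    · simpa [H.map_zero, B_zero] using hu
    · obtain ⟨v, hv, hvt⟩ := hclose _ _ (hxy t ht)
      refine ⟨v, hv, ?_⟩
      rw [← hvt, H.apply_eq x, H.apply_eq y, hθ, hθ, ← rsmul_mul, ← mul_assoc, ← mul_assoc, B_mul_B,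
        add_neg_cancel, B_zero, one_mul, rsmul_mul]
  have hu10 : u 1 0 = 0 := by
    by_contra hne
    have hne' : 0 < |u 1 0 * σ| := abs_pos.mpr (mul_ne_zero hne hσ)
    obtain ⟨t, hty, ht⟩ := (((H.tendsto_atTop y).eventually
      (eventually_ge_atTop (4 / |u 1 0 * σ|))).and (eventually_ge_atTop 0)).exists
    have h1 : |u 1 0 * (σ * h y t) + u 1 1| < 2 := by
      have := (hUN (hmU t ht)).2.2
      simpa [SL2_mul_apply] using this
    have h2 : |u 1 1| < 2 := (hUN hu).2.2
    have h3 : 4 ≤ |u 1 0 * (σ * h y t)| := by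
      rw [← mul_assoc, abs_mul, abs_of_nonneg (H.nonneg y ht)]
      rwa [div_le_iff₀' hne'] at hty
    have h4 := abs_sub_abs_le_abs_sub (u 1 0 * (σ * h y t)) (-u 1 1)
    rw [sub_neg_eq_add, abs_neg] at h4
    linarith
  obtain ⟨r, β, rfl⟩ : ∃ r β, u = upperTri r β := ⟨_, _, eq_upperTri hu10 (hUN hu).1⟩
  have hr : r = 0 := by
    refine eq_zero_of_synchronized (C := (η * |σ| + |β|) / (Real.exp r * |σ|)) (β := β) hfree hopen
      hσ hθ H x fun t ht => ?_
    rw [← hy]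
    have h1 : |Real.exp r * (σ * h y t) + (β + -(σ * h x t) * Real.exp (-r))| < η * |σ| := by
      have := (hUN (hmU t ht)).2.1
      rwa [B_mul_upperTri, upperTri_mul_B, upperTri_01] at this
    rw [le_div_iff₀ (mul_pos (Real.exp_pos r) (abs_pos.mpr hσ)), ← Real.abs_exp r, ← abs_mul,
      ← abs_mul]
    have h2 : (h y t - Real.exp (-(2 * r)) * h x t) * (Real.exp r * σ) =
        (Real.exp r * (σ * h y t) + (β + -(σ * h x t) * Real.exp (-r))) - β := by
      have : Real.exp (-r) = Real.exp (-(2 * r)) * Real.exp r := by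
        rw [← Real.exp_add]; ring_nf
      rw [this]
      ring
    rw [h2]
    exact (abs_sub _ _).trans (by linarith)
  subst hr
  obtain ⟨τ, hτ⟩ := H.surjective x (β / σ)
  refine ⟨τ, hηε x τ ?_, ?_⟩
  · rw [hτ, abs_div, div_lt_iff₀ (abs_pos.mpr hσ)]
    exact (hUN hu).2.1
  · rw [hy, H.apply_eq, hτ, hθ, mul_div_cancel₀ _ hσ, upperTri_zero_left]

theorem IsTimeChange.reverse {M : Type*} [TopologicalSpace M] {ψ φ : Flow ℝ M}
    (H : IsTimeChange ψ φ) : IsTimeChange ψ.reverse φ.reverse := by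
  have horb : ∀ (χ : Flow ℝ M) (x : M), χ.reverse.orbit x = χ.orbit x := fun χ x => by
    rw [Flow.orbit_eq_range, Flow.orbit_eq_range]
    exact (neg_surjective (G := ℝ)).range_comp fun t => χ t x
  intro x
  obtain ⟨h1, h, hc, hm, h0, hh⟩ := H x
  refine ⟨by rw [horb, horb, h1], fun t => -h (-t), by fun_prop,
    fun s t hst => neg_lt_neg (hm (neg_lt_neg hst)), by simpa, fun t => ?_⟩
  rw [Flow.reverse_apply, Flow.reverse_apply, neg_neg, hh]

theorem isNegativeKinematicExpansive_of_reverse {M : Type*} [TopologicalSpace M]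
    {d : M → M → ℝ} {φ : Flow ℝ M} (H : IsPositiveKinematicExpansive d φ.reverse) :
    IsNegativeKinematicExpansive d φ := by
  intro ε hε
  obtain ⟨δ, hδ, hxy⟩ := H ε hε
  refine ⟨δ, hδ, fun x y hclose => ?_⟩
  obtain ⟨τ, hτ, rfl⟩ := hxy x y fun t ht => hclose (-t) (neg_nonpos.mpr ht)
  exact ⟨-τ, by rwa [abs_neg], rfl⟩

end Expansive

/-! ### The unit tangent bundle as a homogeneous space -/

section Quotient

variable (Γ : Subgroup PSL(2, ℝ))

/-- The projection `SL(2, ℝ) → Γ\PSL(2, ℝ) = T¹(Γ\ℍ²)`. -/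
def toT1 (g : SL(2, ℝ)) : T1 Γ := Quotient.mk _ (Xi (g : PSL(2, ℝ)))

theorem isOpenQuotientMap_toT1 : IsOpenQuotientMap (toT1 Γ) := by
  let e : PSL(2, ℝ) ≃ₜ T1H := ⟨Xi, continuous_Xi, continuous_Xi_symm⟩
  exact (isOpenQuotientMap_mk Γ).comp
    ((IsOpenQuotientMap.mk e.surjective e.continuous e.isOpenMap).comp
      QuotientGroup.isOpenQuotientMap_mk)

theorem toT1_eq_toT1 {g g' : SL(2, ℝ)} (h : toT1 Γ g = toT1 Γ g') :
    ((g * g'⁻¹ : SL(2, ℝ)) : PSL(2, ℝ)) ∈ Γ := by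
  obtain ⟨γ, hγ⟩ := Quotient.exact h
  have h1 : Xi ((γ : PSL(2, ℝ)) * (g' : PSL(2, ℝ))) = Xi (g : PSL(2, ℝ)) := by
    rw [Xi_mul]; exact hγ
  have h2 : ((g * g'⁻¹ : SL(2, ℝ)) : PSL(2, ℝ)) = γ := by
    rw [QuotientGroup.mk_mul, QuotientGroup.mk_inv, ← Xi.injective h1, mul_inv_cancel_right]
  rw [h2]
  exact γ.2

/-- The right multiplication action of `SL(2, ℝ)` on `T¹(Γ\ℍ²) = Γ\PSL(2, ℝ)`. -/
abbrev rightMulAction : MulAction SL(2, ℝ)ᵐᵒᵖ (T1 Γ) where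
  smul m := Quotient.map (fun p => Xi (Xi.symm p * (m.unop : PSL(2, ℝ)))) (by
    rintro p q ⟨γ, rfl⟩
    refine ⟨γ, ?_⟩
    change (γ : PSL(2, ℝ)) • Xi _ = Xi (Xi.symm ((γ : PSL(2, ℝ)) • q) * _)
    rw [Xi_symm_smul, mul_assoc]
    exact (Xi_mul _ _).symm)
  one_smul := by
    rintro ⟨p⟩
    refine congrArg (Quotient.mk _) ?_
    simp
  mul_smul m n := by
    rintro ⟨p⟩
    refine congrArg (Quotient.mk _) ?_
    simp [mul_assoc]

attribute [local instance] rightMulAction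

theorem toT1_rsmul (g m : SL(2, ℝ)) : toT1 Γ g <• m = toT1 Γ (g * m) := by
  refine congrArg (Quotient.mk _) ?_
  simp

theorem continuousSMul_rightMulAction : ContinuousSMul SL(2, ℝ)ᵐᵒᵖ (T1 Γ) where
  continuous_smul := by
    rw [((IsOpenQuotientMap.id (X := SL(2, ℝ)ᵐᵒᵖ)).prodMap
      (isOpenQuotientMap_toT1 Γ)).isQuotientMap.continuous_iff]
    have h1 : Continuous fun p : SL(2, ℝ)ᵐᵒᵖ × SL(2, ℝ) => toT1 Γ (p.2 * p.1.unop) :=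
      (isOpenQuotientMap_toT1 Γ).continuous.comp
        (continuous_snd.mul (MulOpposite.continuous_unop.comp continuous_fst))
    exact h1.congr fun p => (toT1_rsmul Γ p.2 p.1.unop).symm

theorem openOrbitMaps_T1 : OpenOrbitMaps (T1 Γ) := by
  intro x U hU
  obtain ⟨g, rfl⟩ := (isOpenQuotientMap_toT1 Γ).surjective x
  have h1 : (fun m : SL(2, ℝ) => toT1 Γ g <• m) '' U = toT1 Γ '' ((fun m => g * m) '' U) := by
    rw [image_image]
    simp only [toT1_rsmul]
  have h2 : (fun m => g * m) '' U ∈ 𝓝 g := by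
    have := (isOpenMap_mul_left g).image_mem_nhds hU
    rwa [mul_one] at this
  rw [h1]
  exact (isOpenQuotientMap_toT1 Γ).isOpenMap.image_mem_nhds h2

theorem horocycleFlow_apply (t : ℝ) (x : T1 Γ) : horocycleFlow Γ t x = x <• B t := by
  obtain ⟨p, rfl⟩ := Quotient.mk_surjective x
  rfl

/-- `T¹(Γ\ℍ²)` is the image of the unit vectors over a compact set of `ℍ²` that meets all orbits
of `Γ`. -/
theorem compactSpace_T1 [CompactSpace (MulAction.orbitRel.Quotient Γ ℍ)] : CompactSpace (T1 Γ) := by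
  have hcont : ∀ γ : Γ, Continuous fun z : ℍ => γ • z := by
    rintro ⟨γ, -⟩
    obtain ⟨g, rfl⟩ := QuotientGroup.mk_surjective γ
    exact continuous_const_smul g
  have : ContinuousConstSMul Γ ℍ := ⟨hcont⟩
  let q : ℍ → MulAction.orbitRel.Quotient Γ ℍ := Quotient.mk _
  have hq : IsOpenMap q := isOpenMap_quotient_mk'_mul
  obtain ⟨K, hK, hKΓ⟩ : ∃ K : Set ℍ, IsCompact K ∧ q '' K = univ := by
    choose N hN hNz using fun z : ℍ => exists_compact_mem_nhds z
    obtain ⟨t, ht⟩ := isCompact_univ.elim_finite_subcover (fun z => interior (q '' N z))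
      (fun z => isOpen_interior) (fun x _ => by
        obtain ⟨z, rfl⟩ := Quotient.mk_surjective x
        exact mem_iUnion.mpr ⟨z, mem_interior_iff_mem_nhds.mpr (hq.image_mem_nhds (hNz z))⟩)
    refine ⟨⋃ z ∈ t, N z, t.isCompact_biUnion fun z _ => hN z, eq_univ_of_univ_subset ?_⟩
    rw [image_iUnion₂]
    exact ht.trans (iUnion₂_mono fun z _ => interior_subset)
  have hT : IsCompact {p : T1H | p.base ∈ K} := by
    obtain ⟨R, hR⟩ := (hK.image UpperHalfPlane.continuous_im).bddAbove
    have hemb : Topology.IsClosedEmbedding (Subtype.val : T1H → ℍ × ℂ) :=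
      (isClosed_eq continuous_snd.norm
        (UpperHalfPlane.continuous_im.comp continuous_fst)).isClosedEmbedding_subtypeVal
    refine (hemb.isCompact_preimage (hK.prod (isCompact_closedBall (0 : ℂ) R))).of_isClosed_subset
      (hK.isClosed.preimage T1H.continuous_base) fun p hp => ⟨hp, ?_⟩
    rw [mem_closedBall_zero_iff]
    exact (T1H.norm_vec p).trans_le (hR (mem_image_of_mem _ hp))
  refine ⟨?_⟩
  convert hT.image (isOpenQuotientMap_mk Γ).continuous
  refine (eq_univ_of_forall fun x => ?_).symm
  obtain ⟨p, rfl⟩ := Quotient.mk_surjective x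
  obtain ⟨z, hz, hzp⟩ : q p.base ∈ q '' K := hKΓ ▸ mem_univ _
  obtain ⟨γ, hγ⟩ := Quotient.exact hzp
  refine ⟨γ • p, ?_, Quotient.sound ⟨γ, rfl⟩⟩
  have h1 : (γ • p).base = z := by
    rw [← hγ]
    obtain ⟨γ, hmem⟩ := γ
    obtain ⟨g, rfl⟩ := QuotientGroup.mk_surjective γ
    rfl
  rw [mem_ofPred_eq, h1]
  exact hz

/-- Cocompactness makes the discreteness of the conjugates `g⁻¹ Γ g`, which are the stabilizers of
the right action, uniform in `g`. -/
theorem uniformlyLocallyFree_T1 [DiscreteTopology Γ] [CompactSpace (T1 Γ)] :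
    UniformlyLocallyFree (T1 Γ) := by
  obtain ⟨V, hV, hVΓ⟩ : ∃ V ∈ 𝓝 (1 : PSL(2, ℝ)), ∀ γ ∈ V, γ ∈ Γ → γ = 1 := by
    have h1 : ({1} : Set Γ) ∈ 𝓝 1 := isOpen_discrete _ |>.mem_nhds rfl
    obtain ⟨V, hV, hsub⟩ := mem_nhds_subtype (Γ : Set PSL(2, ℝ)) 1 {1} |>.mp h1
    exact ⟨V, hV, fun γ hγ hΓ => congrArg Subtype.val (hsub (a := ⟨γ, hΓ⟩) hγ)⟩
  have hone : ∀ᶠ m : SL(2, ℝ) in 𝓝 1, (m : PSL(2, ℝ)) ∈ Γ → m = 1 := by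
    have h1 : ∀ᶠ m : SL(2, ℝ) in 𝓝 1, (m : PSL(2, ℝ)) ∈ V :=
      QuotientGroup.continuous_mk.continuousAt.eventually hV
    have h2 : ∀ᶠ m in 𝓝 (1 : SL(2, ℝ)), 0 < m 0 0 :=
      (continuous_entry 0 0).continuousAt.eventually (lt_mem_nhds (by simp))
    filter_upwards [h1, h2] with m hm hm0 hmΓ
    rcases center_cases ((QuotientGroup.eq_one_iff m).mp (hVΓ _ hm hmΓ)) with h | h
    · exact h
    · rw [h] at hm0
      norm_num at hm0
  have key : ∀ᶠ m in 𝓝 (1 : SL(2, ℝ)), ∀ x ∈ (univ : Set (T1 Γ)), x <• m = x → m = 1 := by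
    refine isCompact_univ.eventually_forall_of_forall_eventually fun x _ => ?_
    obtain ⟨g, rfl⟩ := (isOpenQuotientMap_toT1 Γ).surjective x
    rw [show ((1 : SL(2, ℝ)), toT1 Γ g) = Prod.map id (toT1 Γ) (1, g) from rfl,
      ← ((IsOpenQuotientMap.id (X := SL(2, ℝ))).prodMap
      (isOpenQuotientMap_toT1 Γ)).map_nhds_eq (1, g), eventually_map]
    have h1 : Tendsto (fun p : SL(2, ℝ) × SL(2, ℝ) => p.2 * p.1 * p.2⁻¹) (𝓝 (1, g)) (𝓝 1) := by
      have h2 : Continuous fun p : SL(2, ℝ) × SL(2, ℝ) => p.2 * p.1 * p.2⁻¹ := by fun_prop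
      simpa using h2.tendsto (1, g)
    filter_upwards [h1.eventually hone] with p hp hfix
    have h3 : toT1 Γ (p.2 * p.1) = toT1 Γ p.2 := (toT1_rsmul Γ _ _).symm.trans hfix
    exact conj_eq_one_iff.mp (hp (toT1_eq_toT1 Γ h3))
  exact ⟨_, key, fun x m hm => hm x (mem_univ x)⟩

end Quotient

end HoroExp

end

attribute [local instance] HoroExp.rightMulAction in
/-- `Γ` is a Fuchsian group (a discrete subgroup of `PSL(2, ℝ)`) acting freely on `ℍ²` with compact
quotient `Γ\ℍ²`, and `d` is any metric on `T¹(Γ\ℍ²)` that induces its topology. -/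
theorem theorem3p2 (Γ : Subgroup PSL(2, ℝ)) (hΓ : DiscreteTopology Γ)
    (hfree : ∀ γ ∈ Γ, γ ≠ 1 → ∀ z : ℍ, γ • z ≠ z)
    (hcompact : CompactSpace (MulAction.orbitRel.Quotient Γ ℍ))
    (d : HoroExp.T1 Γ → HoroExp.T1 Γ → ℝ) (hd : HoroExp.IsCompatibleMetric d) :
    HoroExp.IsPositiveStrongKinematicExpansive d (HoroExp.horocycleFlow Γ) ∧
      HoroExp.IsNegativeStrongKinematicExpansive d (HoroExp.horocycleFlow Γ) := by
  let _ : MetricSpace (HoroExp.T1 Γ) := MetricSpace.ofDistTopology d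
    (fun x => (hd.eq_zero_iff x x).mpr rfl) hd.symm hd.triangle hd.isOpen_iff
    (fun x y => (hd.eq_zero_iff x y).mp)
  have := HoroExp.compactSpace_T1 Γ
  have := HoroExp.continuousSMul_rightMulAction Γ
  have hlf := HoroExp.uniformlyLocallyFree_T1 Γ
  have hopen := HoroExp.openOrbitMaps_T1 Γ
  refine ⟨fun ψ hψ => ?_, fun ψ hψ => HoroExp.isNegativeKinematicExpansive_of_reverse ?_⟩
  · exact HoroExp.isPositiveKinematicExpansive_of_isTimeChange hlf hopen one_ne_zero
      (fun t x => by rw [one_mul, HoroExp.horocycleFlow_apply]) hψ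
  · exact HoroExp.isPositiveKinematicExpansive_of_isTimeChange hlf hopen (σ := -1) (by norm_num)
      (fun t x => by rw [neg_one_mul, Flow.reverse_apply, HoroExp.horocycleFlow_apply]) hψ.reverse
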